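/- All rings are commutative with $1$. For a ring $R$, a finitely generated ideal $J$ is a *GV-ideal* if the natural map $R\to\operatorname{Hom}_R(J,R)$, $r\mapsto(x\mapsto rx)$, is an isomorphism. An $R$-module $M$ is *GV-torsion* if every element of $M$ is annihilated by some GV-ideal, and *GV-torsion-free* if $0$ is the only element of $M$ annihilated by some GV-ideal. A *$w$-module* is a GV-torsion-free module $M$ with $\operatorname{Ext}^1_R(R/J,M)=0$ for every GV-ideal $J$. A *maximal $w$-ideal* is an ideal maximal among the proper ideals of $R$ that are $w$-modules; such ideals are prime. A homomorphism $f$ is a *$w$-monomorphism* if $f_{\mathfrak p}$ is injective for every maximal $w$-ideal $\mathfrak p$, and $M$ is *$w$-flat* if $1_M\otimes f$ is a $w$-monomorphism for every $w$-monomorphism $f$. The ring $R$ is a *$w$-IF-ring* if every injective $w$-module is $w$-flat. An $R$-module $M$ is *copure projective* (resp. *$w$-copure projective*) if $\operatorname{Ext}^1_R(M,N)$ is zero (resp. GV-torsion) for every flat $R$-module $N$, and *strongly copure projective* (resp. *strongly $w$-copure projective*) if $\operatorname{Ext}^i_R(M,N)$ is zero (resp. GV-torsion) for every flat $R$-module $N$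 and every $i\ge 1$. An $R$-module $A$ is *absolutely $w$-pure* if $\operatorname{Ext}^1_R(N,A)$ is GV-torsion for every finitely presented $R$-module $N$. **Proposition.** Let $R$ be a coherent domain (an integral domain in which every finitely generated ideal is finitely presented). The following conditions are equivalent: 1. $R$ is a $w$-IF-ring; 2. every finitely presented $R$-module is copure projective; 3. every finitely presented $R$-module is strongly copure projective; 4. every finitely presented $R$-module is $w$-copure projective; 5. every finitely presented $R$-module is strongly $w$-copure projective; 6. $R$, as an $R$-module, is absolutely $w$-pure. -/

import Mathlib

open CategoryTheory

universe u

namespace WCopure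

section Definitions

variable (R : Type u) [CommRing R]

/-- A commutative ring is coherent if every finitely generated ideal is finitely presented. -/
def IsCoherentRing : Prop :=
  ∀ I : Ideal R, I.FG → Module.FinitePresentation R I

variable {R} in
/-- The natural homomorphism `R → Hom_R(J, R)`, sending `r` to multiplication by `r`. -/
def dualMap (J : Ideal R) : R →ₗ[R] (J →ₗ[R] R) :=
  LinearMap.toSpanSingleton R (J →ₗ[R] R) J.subtype

variable {R} in
/-- Glaz-Vasconcelos ideals: finitely generated, with `R → Hom_R(J, R)` an isomorphism. -/
structure IsGVIdeal (J : Ideal R) : Prop where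
  fg : J.FG
  bijective_dualMap : Function.Bijective (dualMap J)

/-- The set `tor_GV(M)` of elements of `M` killed by some GV-ideal. -/
def gvTor (M : Type u) [AddCommGroup M] [Module R M] : Set M :=
  {x | ∃ J : Ideal R, IsGVIdeal J ∧ ∀ a ∈ J, a • x = 0}

/-- `M` is GV-torsion if `tor_GV(M) = M`. -/
def IsGVTorsion (M : Type u) [AddCommGroup M] [Module R M] : Prop :=
  gvTor R M = Set.univ

/-- `M` is GV-torsion-free if `tor_GV(M) = 0`. -/
def IsGVTorsionFree (M : Type u) [AddCommGroup M] [Module R M] : Prop :=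
  gvTor R M = {0}

/-- The `R`-module `Ext^n_R(M, N)`. -/
abbrev ExtMod (M N : Type u) [AddCommGroup M] [Module R M] [AddCommGroup N] [Module R N]
    (n : ℕ) : Type u :=
  Abelian.Ext (ModuleCat.of R M) (ModuleCat.of R N) n

/-- A `w`-module: GV-torsion-free, and `Ext^1_R(R/J, M) = 0` for all GV-ideals `J`. -/
structure IsWModule (M : Type u) [AddCommGroup M] [Module R M] : Prop where
  torsionFree : IsGVTorsionFree R M
  ext_eq_zero : ∀ J : Ideal R, IsGVIdeal J → Subsingleton (ExtMod R (R ⧸ J) M 1)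

variable {R} in
/-- A maximal `w`-ideal: maximal among the proper ideals of `R` that are `w`-modules. -/
def IsMaximalWIdeal (p : Ideal R) : Prop :=
  Maximal (fun I : Ideal R => IsWModule R I ∧ I ≠ ⊤) p

variable {R} in
/-- `f` is a `w`-monomorphism if its localization at every maximal `w`-ideal `p` is injective.
Maximal `w`-ideals are always prime; the binder `[p.IsPrime]` only serves to form the
localization. -/
def IsWMono {A B : Type u} [AddCommGroup A] [Module R A] [AddCommGroup B] [Module R B]
    (f : A →ₗ[R] B) : Prop :=
  ∀ (p : Ideal R) [p.IsPrime], IsMaximalWIdeal p →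
    Function.Injective (LocalizedModule.map p.primeCompl f)

/-- `M` is `w`-flat if `M ⊗ -` preserves `w`-monomorphisms. -/
def IsWFlat (M : Type u) [AddCommGroup M] [Module R M] : Prop :=
  ∀ (A B : Type u) [AddCommGroup A] [Module R A] [AddCommGroup B] [Module R B]
    (f : A →ₗ[R] B), IsWMono f → IsWMono (f.lTensor M)

/-- `R` is a `w`-IF-ring if every injective `w`-module is `w`-flat. -/
def IsWIFRing : Prop :=
  ∀ (E : Type u) [AddCommGroup E] [Module R E],
    Module.Injective R E → IsWModule R E → IsWFlat R E

/-- `Ext^1_R(M, N) = 0` for every flat module `N`. -/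
def IsCopureProjective (M : Type u) [AddCommGroup M] [Module R M] : Prop :=
  ∀ (N : Type u) [AddCommGroup N] [Module R N], Module.Flat R N →
    Subsingleton (ExtMod R M N 1)

/-- `Ext^i_R(M, N) = 0` for every flat module `N` and every `i ≥ 1`. -/
def IsStronglyCopureProjective (M : Type u) [AddCommGroup M] [Module R M] : Prop :=
  ∀ (N : Type u) [AddCommGroup N] [Module R N], Module.Flat R N →
    ∀ i : ℕ, 1 ≤ i → Subsingleton (ExtMod R M N i)

/-- `Ext^1_R(M, N)` is GV-torsion for every flat module `N`. -/
def IsWCopureProjective (M : Type u) [AddCommGroup M] [Module R M] : Prop :=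
  ∀ (N : Type u) [AddCommGroup N] [Module R N], Module.Flat R N →
    IsGVTorsion R (ExtMod R M N 1)

/-- `Ext^i_R(M, N)` is GV-torsion for every flat module `N` and every `i ≥ 1`. -/
def IsStronglyWCopureProjective (M : Type u) [AddCommGroup M] [Module R M] : Prop :=
  ∀ (N : Type u) [AddCommGroup N] [Module R N], Module.Flat R N →
    ∀ i : ℕ, 1 ≤ i → IsGVTorsion R (ExtMod R M N i)

/-- `A` is absolutely `w`-pure if `Ext^1_R(N, A)` is GV-torsion for every finitely presented
module `N`. -/
def IsAbsolutelyWPure (A : Type u) [AddCommGroup A] [Module R A] : Prop :=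
  ∀ (N : Type u) [AddCommGroup N] [Module R N], Module.FinitePresentation R N →
    IsGVTorsion R (ExtMod R N A 1)

end Definitions

end WCopure

/-!
Over a domain each condition says that `R` is a field. For a nonzerodivisor `a` the ideal
`(a) ≅ R` is a `w`-module, so if `a` is not a unit, then `(a)` contains no GV-ideal and lies in a
maximal `w`-ideal `p`. The injective `w`-module `Hom_ℤ(R_p, ℚ/ℤ)` then has nonzero `a`-torsion,
because `a` does not act surjectively on `R_p`, and this torsion survives localization at `p`; so
it is not `w`-flat and `R` is not a `w`-IF-ring. Also, `Ext^1_R(R/(a), R) ≅ R/(a)` is not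
GV-torsion, since a GV-ideal killing the class of `1` would be contained in `(a)`.
-/

namespace WCopure

open Abelian TensorProduct nonZeroDivisors

variable {R : Type u} [CommRing R]

section Ext

/-- The short exact sequence `0 → K → P → P ⧸ K → 0` of a submodule `K` of `P`. -/
abbrev submoduleShortComplex {P : Type u} [AddCommGroup P] [Module R P] (K : Submodule R P) :
    ShortComplex (ModuleCat.{u} R) where
  f := ModuleCat.ofHom K.subtype
  g := ModuleCat.ofHom K.mkQ
  zero := by
    ext x
    exact (Submodule.Quotient.mk_eq_zero K).mpr x.2

variable {P : Type u} [AddCommGroup P] [Module R P] (K : Submodule R P)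

lemma submoduleShortComplex_shortExact : (submoduleShortComplex K).ShortExact where
  exact := (ShortComplex.ShortExact.moduleCat_exact_iff_function_exact _).mpr
    (LinearMap.exact_subtype_mkQ K)
  mono_f := (ModuleCat.mono_iff_injective _).mpr K.injective_subtype
  epi_g := (ModuleCat.epi_iff_surjective _).mpr K.mkQ_surjective

variable (M : Type u) [AddCommGroup M] [Module R M]

/-- The connecting homomorphism `Hom_R(K, M) → Ext^1_R(P ⧸ K, M)` of the contravariant long exact
sequence of `0 → K → P → P ⧸ K → 0`. -/
noncomputable def connectingHom : (K →ₗ[R] M) →ₗ[R] ExtMod R (P ⧸ K) M 1 where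
  toFun f := (submoduleShortComplex_shortExact K).extClass.comp
    (Ext.mk₀ (ModuleCat.ofHom f)) (add_zero 1)
  map_add' f g := by rw [ModuleCat.ofHom_add, Ext.mk₀_add, Ext.comp_add]
  map_smul' r f := by
    rw [show ModuleCat.ofHom (r • f) = r • ModuleCat.ofHom f from rfl, Ext.mk₀_smul,
      Ext.comp_smul, RingHom.id_apply]

lemma exact_lcomp_connectingHom :
    Function.Exact (LinearMap.lcomp R M K.subtype) (connectingHom K M) := by
  have hS := submoduleShortComplex_shortExact K
  refine fun f => ⟨fun hf => ?_, ?_⟩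
  · obtain ⟨y, hy⟩ := Ext.contravariant_sequence_exact₁ hS (ModuleCat.of R M) _ (add_zero 1) hf
    obtain ⟨g, rfl⟩ := Ext.mk₀_bijective _ _ |>.2 y
    rw [Ext.mk₀_comp_mk₀] at hy
    exact ⟨g.hom, congrArg ModuleCat.Hom.hom (Ext.mk₀_bijective _ _ |>.1 hy)⟩
  · rintro ⟨g, rfl⟩
    change hS.extClass.comp
      (Ext.mk₀ ((submoduleShortComplex K).f ≫ ModuleCat.ofHom g)) (add_zero 1) = 0
    rw [← Ext.mk₀_comp_mk₀, hS.extClass_comp_assoc]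

lemma connectingHom_surjective [Module.Projective R P] :
    Function.Surjective (connectingHom K M) :=
  (precomp_extClass_surjective_of_projective_X₂ (ModuleCat.of R M)
    (submoduleShortComplex_shortExact K) 0).comp
    ((Ext.mk₀_bijective _ _).surjective.comp ModuleCat.homEquiv.symm.surjective)

lemma subsingleton_ext_one_quotient_iff [Module.Projective R P] :
    Subsingleton (ExtMod R (P ⧸ K) M 1) ↔ Function.Surjective (LinearMap.lcomp R M K.subtype) := by
  rw [subsingleton_iff_forall_eq 0, (connectingHom_surjective K M).forall]
  exact forall_congr' (exact_lcomp_connectingHom K M)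

end Ext

section GVIdeal

lemma isGVIdeal_iff (J : Ideal R) :
    IsGVIdeal J ↔ J.FG ∧ Function.Bijective (LinearMap.lcomp R R J.subtype) := by
  have h : dualMap J =
      LinearMap.lcomp R R J.subtype ∘ₗ (LinearMap.ringLmapEquivSelf R R R).symm.toLinearMap := by
    ext
    simp [dualMap]
  have hbij : Function.Bijective (dualMap J) ↔
      Function.Bijective (LinearMap.lcomp R R J.subtype) := by
    rw [h, LinearMap.coe_comp, LinearEquiv.coe_coe, EquivLike.bijective_comp]
  exact ⟨fun hJ => ⟨hJ.fg, hbij.mp hJ.bijective_dualMap⟩, fun hJ => ⟨hJ.1, hbij.mpr hJ.2⟩⟩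

lemma isGVIdeal_top : IsGVIdeal (⊤ : Ideal R) :=
  (isGVIdeal_iff ⊤).mpr ⟨Module.Finite.fg_top,
    (LinearEquiv.congrLeft R R (Submodule.topEquiv (R := R) (M := R)).symm).bijective⟩

variable {M : Type u} [AddCommGroup M] [Module R M]

lemma isGVTorsion_of_subsingleton [Subsingleton M] : IsGVTorsion R M :=
  Set.eq_univ_of_forall fun _ => ⟨⊤, isGVIdeal_top, fun _ _ => Subsingleton.elim _ _⟩

lemma isGVTorsionFree_iff :
    IsGVTorsionFree R M ↔
      ∀ J : Ideal R, IsGVIdeal J → ∀ x : M, (∀ a ∈ J, a • x = 0) → x = 0 := by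
  have h0 : (0 : M) ∈ gvTor R M := ⟨⊤, isGVIdeal_top, fun _ _ => smul_zero _⟩
  rw [IsGVTorsionFree, Set.eq_singleton_iff_unique_mem, and_iff_right h0]
  exact ⟨fun h J hJ x hx => h x ⟨J, hJ, hx⟩, fun h x ⟨J, hJ, hx⟩ => h J hJ x hx⟩

lemma injective_lcomp_subtype_iff (J : Ideal R) :
    Function.Injective (LinearMap.lcomp R M J.subtype) ↔
      ∀ x : M, (∀ a ∈ J, a • x = 0) → x = 0 := by
  rw [injective_iff_map_eq_zero,
    (LinearMap.ringLmapEquivSelf R R M).symm.surjective.forall]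
  simp only [EmbeddingLike.map_eq_zero_iff]
  simp [LinearMap.ext_iff]

end GVIdeal

section WModule

variable {M N : Type u} [AddCommGroup M] [Module R M] [AddCommGroup N] [Module R N]

lemma isWModule_iff :
    IsWModule R M ↔ ∀ J : Ideal R, IsGVIdeal J →
      Function.Bijective (LinearMap.lcomp R M J.subtype) := by
  have h : IsWModule R M ↔ IsGVTorsionFree R M ∧
      ∀ J : Ideal R, IsGVIdeal J → Subsingleton (ExtMod R (R ⧸ J) M 1) :=
    ⟨fun h => ⟨h.torsionFree, h.ext_eq_zero⟩, fun h => ⟨h.1, h.2⟩⟩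
  simp only [h, isGVTorsionFree_iff, subsingleton_ext_one_quotient_iff, Function.Bijective,
    injective_lcomp_subtype_iff, forall_and]

lemma isWModule_self : IsWModule R R :=
  isWModule_iff.mpr fun J hJ => ((isGVIdeal_iff J).mp hJ).2

lemma IsWModule.of_linearEquiv (hM : IsWModule R M) (e : M ≃ₗ[R] N) : IsWModule R N := by
  refine isWModule_iff.mpr fun J hJ => ?_
  rw [← EquivLike.bijective_comp e.congrRight]
  exact e.congrRight.bijective.comp (isWModule_iff.mp hM J hJ)

lemma IsWModule.eq_of_smul_eq (hM : IsWModule R M) {J : Ideal R} (hJ : IsGVIdeal J) {x y : M}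
    (h : ∀ a ∈ J, a • x = a • y) : x = y :=
  sub_eq_zero.mp <| isGVTorsionFree_iff.mp hM.torsionFree J hJ _ fun a ha => by
    rw [smul_sub, h a ha, sub_self]

lemma IsWModule.exists_eq_smul (hM : IsWModule R M) {J : Ideal R} (hJ : IsGVIdeal J)
    (f : J →ₗ[R] M) : ∃ x : M, ∀ a : J, f a = (a : R) • x := by
  obtain ⟨g, rfl⟩ := (isWModule_iff.mp hM J hJ).2 f
  exact ⟨g 1, fun a => by simp [← map_smul]⟩

lemma isWModule_submodule_iff (hM : IsWModule R M) {L : Submodule R M} :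
    IsWModule R L ↔ ∀ J : Ideal R, IsGVIdeal J → ∀ x : M, (∀ a ∈ J, a • x ∈ L) → x ∈ L := by
  refine ⟨fun hL J hJ x hx => ?_, fun h => isWModule_iff.mpr fun J hJ => ⟨?_, fun f => ?_⟩⟩
  · let f : J →ₗ[R] L :=
      (LinearMap.toSpanSingleton R M x ∘ₗ J.subtype).codRestrict L fun a => hx a a.2
    obtain ⟨y, hy⟩ := hL.exists_eq_smul hJ f
    have hxy : x = y := hM.eq_of_smul_eq hJ fun a ha => congrArg Subtype.val (hy ⟨a, ha⟩)
    exact hxy ▸ y.2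
  · refine (injective_lcomp_subtype_iff J).mpr fun x hx => Subtype.ext ?_
    exact hM.eq_of_smul_eq hJ fun a ha => by simpa using congrArg Subtype.val (hx a ha)
  · obtain ⟨x, hx⟩ := hM.exists_eq_smul hJ (L.subtype ∘ₗ f)
    have hxL : x ∈ L := h J hJ x fun a ha => hx ⟨a, ha⟩ ▸ (f ⟨a, ha⟩).2
    exact ⟨LinearMap.toSpanSingleton R L ⟨x, hxL⟩,
      LinearMap.ext fun a => Subtype.ext (hx a).symm⟩

lemma IsWModule.comap (hM : IsWModule R M) (hN : IsWModule R N) {L : Submodule R N}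
    (hL : IsWModule R L) (f : M →ₗ[R] N) : IsWModule R (L.comap f) :=
  (isWModule_submodule_iff hM).mpr fun J hJ x hx =>
    (isWModule_submodule_iff hN).mp hL J hJ (f x) fun a ha => by simpa using hx a ha

lemma IsWModule.sSup_of_directedOn (hM : IsWModule R M) {c : Set (Submodule R M)}
    (hne : c.Nonempty) (hdir : DirectedOn (· ≤ ·) c) (hc : ∀ L ∈ c, IsWModule R L) :
    IsWModule R ↥(sSup c) := by
  refine (isWModule_submodule_iff hM).mpr fun J hJ x hx => ?_
  have hle : Submodule.map (LinearMap.toSpanSingleton R M x) J ≤ sSup c :=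
    Submodule.map_le_iff_le_comap.mpr hx
  obtain ⟨L, hL, hJL⟩ := (Submodule.fg_iff_compact _).mp (Submodule.FG.map _ hJ.fg) c _ hne hdir
    (isLUB_sSup c) hle
  exact le_sSup hL <| (isWModule_submodule_iff hM).mp (hc L hL) J hJ x fun a ha =>
    hJL ⟨a, ha, rfl⟩

lemma isWModule_of_injective [Module.Injective R M] (h : IsGVTorsionFree R M) :
    IsWModule R M where
  torsionFree := h
  ext_eq_zero J _ := (subsingleton_ext_one_quotient_iff J M).mpr <|
    Module.Baer.iff_surjective.mp (Module.Baer.of_injective inferInstance) J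

end WModule

section WIdeal

lemma IsGVIdeal.eq_top_of_le {I J : Ideal R} (hJ : IsGVIdeal J) (hI : IsWModule R I)
    (hJI : J ≤ I) : I = ⊤ :=
  (Ideal.eq_top_iff_one I).mpr <| (isWModule_submodule_iff isWModule_self).mp hI J hJ 1
    fun a ha => by simpa using hJI ha

/-- A nonzerodivisor `a` as a basis of the principal ideal `(a)`: the isomorphism `R ≃ (a)` given
by multiplication by `a`. -/
noncomputable def spanSingletonEquiv {a : R} (ha : a ∈ R⁰) : R ≃ₗ[R] Ideal.span {a} :=
  LinearEquiv.ofInjective (LinearMap.toSpanSingleton R R a)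
      (fun _ _ h => (mul_cancel_right_mem_nonZeroDivisors ha).mp h) ≪≫ₗ
    LinearEquiv.ofEq _ _ (LinearMap.range_toSpanSingleton a)

lemma coe_spanSingletonEquiv_apply {a : R} (ha : a ∈ R⁰) (r : R) :
    (spanSingletonEquiv ha r : R) = r * a := rfl

lemma isWModule_span_singleton {a : R} (ha : a ∈ R⁰) : IsWModule R (Ideal.span {a}) :=
  isWModule_self.of_linearEquiv (spanSingletonEquiv ha)

lemma IsMaximalWIdeal.isPrime {p : Ideal R} (hp : IsMaximalWIdeal p) : p.IsPrime := by
  refine ⟨hp.prop.2, fun {x y} hxy => or_iff_not_imp_left.mpr fun hx => ?_⟩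
  let q : Ideal R := Submodule.comap (LinearMap.mulRight R x) p
  have hpq : p ≤ q := fun r hr => p.mul_mem_right x hr
  have hq : IsWModule R q := isWModule_self.comap isWModule_self hp.prop.1 _
  have hqt : q ≠ ⊤ := fun h => hx (by simpa [q] using (Ideal.eq_top_iff_one q).mp h)
  exact hp.le_of_ge ⟨hq, hqt⟩ hpq (by simpa [q, mul_comm] using hxy)

lemma exists_le_isMaximalWIdeal {I : Ideal R} (hI : IsWModule R I) (hIt : I ≠ ⊤) :
    ∃ p : Ideal R, I ≤ p ∧ IsMaximalWIdeal p := by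
  refine zorn_le_nonempty₀ {I : Ideal R | IsWModule R I ∧ I ≠ ⊤} ?_ I ⟨hI, hIt⟩
  intro c hc hchain K hK
  have hdir : DirectedOn (· ≤ ·) c := hchain.directedOn
  refine ⟨sSup c, ⟨isWModule_self.sSup_of_directedOn ⟨K, hK⟩ hdir fun L hL => (hc hL).1,
    fun h => ?_⟩, fun _ => le_sSup⟩
  obtain ⟨L, hL, h1⟩ := (Submodule.mem_sSup_of_directed ⟨K, hK⟩ hdir).mp
    ((Ideal.eq_top_iff_one _).mp h)
  exact (hc hL).2 ((Ideal.eq_top_iff_one L).mpr h1)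

end WIdeal

section CharacterModule

lemma isSMulRegular_characterModule_iff {M : Type*} [AddCommGroup M] [Module R M] {a : R} :
    IsSMulRegular (CharacterModule M) a ↔ Function.Surjective fun x : M => a • x := by
  have h : ⇑(CharacterModule.dual (LinearMap.lsmul R M a)) = fun c => a • c := rfl
  rw [IsSMulRegular, ← h, CharacterModule.dual_injective_iff_surjective]
  rfl

variable (p : Ideal R) [p.IsPrime]

lemma isSMulRegular_characterModule_atPrime_iff {a : R} :
    IsSMulRegular (CharacterModule (Localization.AtPrime p)) a ↔ a ∉ p := by
  rw [isSMulRegular_characterModule_iff, ← Ideal.mem_primeCompl_iff,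
    ← IsLocalization.AtPrime.isUnit_to_map_iff (Localization.AtPrime p) p]
  simp only [Algebra.smul_def]
  refine ⟨fun h => ?_, fun h => (IsUnit.isUnit_iff_mulLeft_bijective.mp h).2⟩
  obtain ⟨b, hb⟩ := h 1
  exact .of_mul_eq_one b hb

instance : Module.Injective R (CharacterModule (Localization.AtPrime p)) :=
  Module.Flat.iff_characterModule_injective.mp (IsLocalization.flat _ p.primeCompl)

lemma isWModule_characterModule_atPrime (hp : IsWModule R p) :
    IsWModule R (CharacterModule (Localization.AtPrime p)) := by
  refine isWModule_of_injective (isGVTorsionFree_iff.mpr fun J hJ c hc => ?_)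
  obtain ⟨s, hsJ, hsp⟩ := SetLike.not_le_iff_exists.mp
    (mt (hJ.eq_top_of_le hp) Ideal.IsPrime.ne_top')
  exact ((isSMulRegular_characterModule_atPrime_iff p).mpr hsp).right_eq_zero_of_smul (hc s hsJ)

end CharacterModule

section WFlat

lemma localizedModule_mk_eq_zero_iff {S : Submonoid R} {A : Type*} [AddCommGroup A] [Module R A]
    {x : A} {s : S} : LocalizedModule.mk x s = 0 ↔ ∃ t ∈ S, t • x = 0 := by
  rw [← LocalizedModule.zero_mk 1, LocalizedModule.mk_eq]
  simp [Submonoid.smul_def]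

lemma localizedModule_map_injective_iff {A B : Type*} [AddCommGroup A] [Module R A]
    [AddCommGroup B] [Module R B] (S : Submonoid R) (f : A →ₗ[R] B) :
    Function.Injective (LocalizedModule.map S f) ↔ ∀ x, f x = 0 → ∃ s ∈ S, s • x = 0 := by
  rw [injective_iff_map_eq_zero]
  refine ⟨fun h x hx => localizedModule_mk_eq_zero_iff.mp (h (LocalizedModule.mk x 1) ?_),
    fun h y hy => ?_⟩
  · rw [LocalizedModule.map_mk, hx, LocalizedModule.zero_mk]
  · induction y with | h x s
    rw [LocalizedModule.map_mk, localizedModule_mk_eq_zero_iff] at hy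
    obtain ⟨t, ht, htx⟩ := hy
    obtain ⟨u, hu, hux⟩ := h (t • x) (by rw [map_smul, htx])
    exact localizedModule_mk_eq_zero_iff.mpr
      ⟨u * t, S.mul_mem hu ht, by rw [mul_smul, hux]⟩

lemma exists_smul_tensor_eq_zero {S : Submonoid R} {M K : Type*} [AddCommGroup M] [Module R M]
    [AddCommGroup K] [Module R K] (hK : ∀ x : K, ∃ s ∈ S, s • x = 0) (z : M ⊗[R] K) :
    ∃ s ∈ S, s • z = 0 := by
  induction z with
  | zero => exact ⟨1, S.one_mem, smul_zero 1⟩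
  | tmul m x =>
    obtain ⟨s, hs, hsx⟩ := hK x
    exact ⟨s, hs, by rw [← tmul_smul, hsx, tmul_zero]⟩
  | add y z hy hz =>
    obtain ⟨s, hs, hsy⟩ := hy
    obtain ⟨t, ht, htz⟩ := hz
    exact ⟨t * s, S.mul_mem ht hs, by
      rw [smul_add, mul_smul, hsy, mul_comm, mul_smul, htz, smul_zero, smul_zero, add_zero]⟩

variable {A B M : Type u} [AddCommGroup A] [Module R A] [AddCommGroup B] [Module R B]
  [AddCommGroup M] [Module R M]

lemma isWMono_iff (f : A →ₗ[R] B) :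
    IsWMono f ↔ ∀ p : Ideal R, IsMaximalWIdeal p → ∀ x, f x = 0 → ∃ s ∉ p, s • x = 0 := by
  simp only [IsWMono, localizedModule_map_injective_iff, Ideal.mem_primeCompl_iff]
  exact ⟨fun h p hp => have := hp.isPrime; h p hp, fun h p _ hp => h p hp⟩

lemma isWFlat_of_flat [Module.Flat R M] : IsWFlat R M := by
  intro A B _ _ _ _ f hf
  refine (isWMono_iff _).mpr fun p hp z hz => ?_
  have := hp.isPrime
  have hker (x : LinearMap.ker f) : ∃ s ∈ p.primeCompl, s • x = 0 := by
    obtain ⟨s, hsp, hsx⟩ := (isWMono_iff f).mp hf p hp x x.2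
    exact ⟨s, hsp, Subtype.ext hsx⟩
  obtain ⟨k, rfl⟩ := (Module.Flat.lTensor_exact M (LinearMap.exact_subtype_ker_map f) z).mp hz
  obtain ⟨s, hsp, hsk⟩ := exists_smul_tensor_eq_zero hker k
  exact ⟨s, hsp, by rw [← map_smul, hsk, map_zero]⟩

lemma IsWFlat.exists_smul_eq_zero (h : IsWFlat R M) {a : R} (ha : a ∈ R⁰) {x : M}
    (hx : a • x = 0) {p : Ideal R} (hp : IsMaximalWIdeal p) : ∃ s ∉ p, s • x = 0 := by
  have hmono : IsWMono (LinearMap.mulLeft R a) := (isWMono_iff _).mpr fun q hq r hr =>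
    ⟨1, q.ne_top_iff_one.mp hq.prop.2,
      by rw [one_smul]; exact (mul_left_mem_nonZeroDivisors_eq_zero_iff ha).mp hr⟩
  obtain ⟨s, hsp, hs⟩ := (isWMono_iff _).mp (h _ _ _ hmono) p hp (x ⊗ₜ 1) (by
    rw [LinearMap.lTensor_tmul, LinearMap.mulLeft_apply, ← smul_eq_mul, ← smul_tmul, hx, zero_tmul])
  exact ⟨s, hsp, by simpa using congrArg (TensorProduct.rid R M) hs⟩

end WFlat

section Units

variable {a : R}

lemma IsWIFRing.isUnit_of_mem_nonZeroDivisors (h : IsWIFRing R) (ha : a ∈ R⁰) : IsUnit a := by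
  by_contra hau
  obtain ⟨p, hap, hp⟩ := exists_le_isMaximalWIdeal (isWModule_span_singleton ha)
    (mt Ideal.span_singleton_eq_top.mp hau)
  have := hp.isPrime
  have hE : IsWFlat R (CharacterModule (Localization.AtPrime p)) :=
    h _ inferInstance (isWModule_characterModule_atPrime p hp.prop.1)
  have hreg : ¬ IsSMulRegular (CharacterModule (Localization.AtPrime p)) a :=
    mt (isSMulRegular_characterModule_atPrime_iff p).mp
      (not_not_intro (hap (Ideal.mem_span_singleton_self a)))
  refine hreg (IsSMulRegular.of_right_eq_zero_of_smul fun c hac => ?_)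
  obtain ⟨s, hsp, hsc⟩ := hE.exists_smul_eq_zero ha hac hp
  exact ((isSMulRegular_characterModule_atPrime_iff p).mpr hsp).right_eq_zero_of_smul hsc

lemma IsAbsolutelyWPure.isUnit_of_mem_nonZeroDivisors (h : IsAbsolutelyWPure R R)
    (ha : a ∈ R⁰) : IsUnit a := by
  have hfp : Module.FinitePresentation R (R ⧸ Ideal.span {a}) :=
    Module.finitePresentation_of_surjective (Ideal.span {a}).mkQ (Submodule.mkQ_surjective _)
      (by rw [Submodule.ker_mkQ]; exact ⟨{a}, by simp⟩)
  let g : Ideal.span {a} →ₗ[R] R := (spanSingletonEquiv ha).symm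
  obtain ⟨J, hJ, hJg⟩ : connectingHom (Ideal.span {a}) R g ∈ gvTor R _ :=
    (h _ hfp).symm ▸ Set.mem_univ _
  refine Ideal.span_singleton_eq_top.mp
    (hJ.eq_top_of_le (isWModule_span_singleton ha) fun r hr => Ideal.mem_span_singleton.mpr ?_)
  obtain ⟨f, hf⟩ := (exact_lcomp_connectingHom (Ideal.span {a}) R (r • g)).mp
    ((map_smul _ r g).trans (hJg r hr))
  have hfa : f a = r := by
    simpa [g, coe_spanSingletonEquiv_apply] using LinearMap.congr_fun hf (spanSingletonEquiv ha 1)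
  exact ⟨f 1, by rw [← hfa, ← smul_eq_mul, ← map_smul, smul_eq_mul, mul_one]⟩

end Units

section IsField

lemma isField_of_forall_isUnit [IsDomain R] (h : ∀ a ∈ R⁰, IsUnit a) : IsField R := by
  by_contra hR
  obtain ⟨a, ha, hau⟩ := Ring.exists_not_isUnit_of_not_isField hR
  exact hau (h a (mem_nonZeroDivisors_of_ne_zero ha))

lemma isWIFRing_of_isField (hR : IsField R) : IsWIFRing R := by
  let := hR.toField
  exact fun E _ _ _ _ => isWFlat_of_flat

lemma isStronglyCopureProjective_of_projective {M : Type u} [AddCommGroup M] [Module R M]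
    [Module.Projective R M] : IsStronglyCopureProjective R M := by
  intro N _ _ _ i hi
  obtain ⟨n, rfl⟩ := Nat.exists_eq_add_of_le' hi
  exact subsingleton_of_forall_eq 0 Ext.eq_zero_of_projective

lemma isStronglyCopureProjective_of_isField (hR : IsField R) (M : Type u) [AddCommGroup M]
    [Module R M] : IsStronglyCopureProjective R M := by
  let := hR.toField
  exact isStronglyCopureProjective_of_projective

end IsField

end WCopure

open WCopure in
theorem proposition3p3_general (R : Type u) [CommRing R] [IsDomain R] :
    List.TFAE [
      IsField R,
      IsWIFRing R,
      ∀ (M : Type u) [AddCommGroup M] [Module R M], Module.FinitePresentation R M →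
        IsCopureProjective R M,
      ∀ (M : Type u) [AddCommGroup M] [Module R M], Module.FinitePresentation R M →
        IsStronglyCopureProjective R M,
      ∀ (M : Type u) [AddCommGroup M] [Module R M], Module.FinitePresentation R M →
        IsWCopureProjective R M,
      ∀ (M : Type u) [AddCommGroup M] [Module R M], Module.FinitePresentation R M →
        IsStronglyWCopureProjective R M,
      IsAbsolutelyWPure R R] := by
  tfae_have 1 → 2 := isWIFRing_of_isField
  tfae_have 2 → 1 := fun h =>
    isField_of_forall_isUnit fun _ => h.isUnit_of_mem_nonZeroDivisors
  tfae_have 1 → 4 := fun h M _ _ _ => isStronglyCopureProjective_of_isField h M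
  tfae_have 4 → 3 := fun h M _ _ hM N _ _ hN => h M hM N hN 1 le_rfl
  tfae_have 4 → 6 := fun h M _ _ hM N _ _ hN i hi =>
    have := h M hM N hN i hi
    isGVTorsion_of_subsingleton
  tfae_have 3 → 5 := fun h M _ _ hM N _ _ hN =>
    have := h M hM N hN
    isGVTorsion_of_subsingleton
  tfae_have 6 → 5 := fun h M _ _ hM N _ _ hN => h M hM N hN 1 le_rfl
  tfae_have 5 → 7 := fun h N _ _ hN => h N hN R inferInstance
  tfae_have 7 → 1 := fun h =>
    isField_of_forall_isUnit fun _ => h.isUnit_of_mem_nonZeroDivisors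
  tfae_finish

theorem proposition3p3 (R : Type u) [CommRing R] [IsDomain R]
    (hR : WCopure.IsCoherentRing R) :
    List.TFAE [
      WCopure.IsWIFRing R,
      ∀ (M : Type u) [AddCommGroup M] [Module R M], Module.FinitePresentation R M →
        WCopure.IsCopureProjective R M,
      ∀ (M : Type u) [AddCommGroup M] [Module R M], Module.FinitePresentation R M →
        WCopure.IsStronglyCopureProjective R M,
      ∀ (M : Type u) [AddCommGroup M] [Module R M], Module.FinitePresentation R M →
        WCopure.IsWCopureProjective R M,
      ∀ (M : Type u) [AddCommGroup M] [Module R M], Module.FinitePresentation R M →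
        WCopure.IsStronglyWCopureProjective R M,
      WCopure.IsAbsolutelyWPure R R] :=
  (List.tfae_cons_cons.mp (proposition3p3_general R)).2
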